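/- Let $H\in\mathbb{R}^{M\times N}$ have columns indexed by $\mathcal V$ ($|\mathcal V|=N$), let $\mathcal L$ be a set of rows (the load measurements) and let $\Lambda_i\subseteq\mathcal V$ be a nonempty known attack support. Write $H_{\mathcal L,\mathcal V}$ for the submatrix of $H$ with rows $\mathcal L$ and all columns, and $H_{\mathcal L,\Lambda_i}$ for the one with rows $\mathcal L$ and columns $\Lambda_i$. Assume that $H_{\mathcal L,\Lambda_i}$ has full column rank and put $P_{\Lambda_i}=H_{\mathcal L,\Lambda_i}(H_{\mathcal L,\Lambda_i}^TH_{\mathcal L,\Lambda_i})^{-1}H_{\mathcal L,\Lambda_i}^T$. Let $\sigma_e>0$, let $\Delta e_{\mathcal L}\sim\mathcal N(0,\sigma_e^2I)$, and consider the binary test $$\mathcal H_0:\ \Delta z_{\mathcal L}=H_{\mathcal L,\mathcal V}\Delta\theta+\Delta e_{\mathcal L},\qquad \mathcal H_i:\ \Delta z_{\mathcal L}=H_{\mathcal L,\Lambda_i}c+H_{\mathcal L,\mathcal V}\Delta\theta+\Delta e_{\mathcal L}\ \text{ with }\ P_{\Lambda_i}H_{\mathcal L,\mathcal V}\Delta\theta=0,$$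 with unknown attack $c\in\mathbb{R}^{\Lambda_i}$ and state change $\Delta\theta\in\mathbb{R}^{\mathcal V}$. (i) Let $f(z;m)$ be the density of $\mathcal N(m,\sigma_e^2I)$ at $z$. For every $z\in\mathbb{R}^{\mathcal L}$ and every $\Delta\theta$ with $P_{\Lambda_i}H_{\mathcal L,\mathcal V}\Delta\theta=0$, the generalized likelihood ratio statistic, with $c$ maximized out, is $$2\ln\frac{\sup_{c}f(z;H_{\mathcal L,\Lambda_i}c+H_{\mathcal L,\mathcal V}\Delta\theta)}{f(z;H_{\mathcal L,\mathcal V}\Delta\theta)}=T(z):=\frac1{\sigma_e^2}\|P_{\Lambda_i}z\|^2 .$$ Accordingly the GLRT with threshold $\gamma\ge 0$ decides $\mathcal H_i$ when $T(\Delta z_{\mathcal L})>\gamma$. (ii) Let the actual load change $\Delta\theta$ satisfy $\|H_{\mathcal L,\mathcal V}\Delta\theta\|^2<\eta$ (the constraint $P_{\Lambda_i}H_{\mathcal L,\mathcal V}\Delta\theta=0$ is not required here). Then the false-alarm probability $P_{fa}=\Pr\big(T(H_{\mathcal L,\mathcal V}\Delta\theta+\Delta e_{\mathcal L})>\gamma\big)$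 satisfies $$Q_{|\Lambda_i|/2}\big(0,\sqrt\gamma\big)\ \le\ P_{fa}\ \le\ Q_{|\Lambda_i|/2}\Big(\frac{\sqrt\eta}{\sigma_e},\sqrt\gamma\Big),$$ where $Q_v(a,b)=a^{1-v}\int_b^\infty t^ve^{-(t^2+a^2)/2}I_{v-1}(at)\,dt$ for $a>0$ is the generalized Marcum $Q$-function, $I_{v-1}$ is the modified Bessel function of the first kind, and $Q_v(0,b)=\frac{1}{2^{v-1}\Gamma(v)}\int_b^\infty t^{2v-1}e^{-t^2/2}\,dt$ is its continuous extension to $a=0$. -/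

import Mathlib

open MeasureTheory ProbabilityTheory

namespace FDI

noncomputable section

/-- Modified Bessel function of the first kind of real order `μ`,
`I_μ(x) = ∑ₖ (x/2)^(2k+μ) / (k! Γ(k+μ+1))`, for `x > 0`. -/
def besselI (μ x : ℝ) : ℝ :=
  ∑' k : ℕ, (x / 2) ^ (2 * (k : ℝ) + μ) / ((k.factorial : ℝ) * Real.Gamma ((k : ℝ) + μ + 1))

/-- Generalized Marcum `Q`-function of real order `v > 0`, for `a, b ≥ 0`:
`Q_v(a, b) = a^(1-v) ∫_b^∞ t^v exp(-(t² + a²)/2) I_{v-1}(a t) dt` for `a > 0`, with its continuous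
extension `Q_v(0, b) = (2^(v-1) Γ(v))⁻¹ ∫_b^∞ t^(2v-1) exp(-t²/2) dt` at `a = 0`. -/
def marcumQ (v a b : ℝ) : ℝ :=
  if a = 0 then
    ((2 : ℝ) ^ (v - 1) * Real.Gamma v)⁻¹ *
      ∫ t in Set.Ioi b, t ^ (2 * v - 1) * Real.exp (-t ^ 2 / 2)
  else
    a ^ (1 - v) *
      ∫ t in Set.Ioi b, t ^ v * Real.exp (-(t ^ 2 + a ^ 2) / 2) * besselI (v - 1) (a * t)

variable {M V : Type*} [Fintype M] [DecidableEq M] [Fintype V] [DecidableEq V]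

/-- `H_{L,V}`: the rows of `H` indexed by the set `L` of load measurements. -/
def loadMatrix (H : Matrix M V ℝ) (L : Finset M) : Matrix L V ℝ :=
  H.submatrix (fun l : L => (l : M)) id

/-- `H_{L,Λ}`: the rows of `H` indexed by `L` and the columns indexed by the support `Λ`. -/
def attackMatrix (H : Matrix M V ℝ) (L : Finset M) (Λ : Finset V) : Matrix L Λ ℝ :=
  H.submatrix (fun l : L => (l : M)) (fun n : Λ => (n : V))

/-- `P_Λ = A (Aᵀ A)⁻¹ Aᵀ` with `A = H_{L,Λ}`. -/
def attackProj (H : Matrix M V ℝ) (L : Finset M) (Λ : Finset V) : Matrix L L ℝ :=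
  attackMatrix H L Λ * ((attackMatrix H L Λ).transpose * attackMatrix H L Λ)⁻¹ *
    (attackMatrix H L Λ).transpose

/-- Density at `z` of the law `N(m, σ² I)` on `ℝ^L`. -/
def gaussianLikelihood {L : Finset M} (σ : ℝ) (m z : EuclideanSpace ℝ L) : ℝ :=
  (2 * Real.pi * σ ^ 2) ^ (-((L.card : ℝ) / 2)) * Real.exp (-‖z - m‖ ^ 2 / (2 * σ ^ 2))

/-- Twice the logarithm of the generalized likelihood ratio
`sup_c f(z ; H_{L,Λ} c + H_{L,V} Δθ) / f(z ; H_{L,V} Δθ)`: the attack `c` with support `Λ` is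
unknown and maximized out, and `Δθ` is the nuisance state change. -/
def logGLR (H : Matrix M V ℝ) (L : Finset M) (Λ : Finset V) (σ : ℝ)
    (Δθ : EuclideanSpace ℝ V) (z : EuclideanSpace ℝ L) : ℝ :=
  2 * Real.log
    ((⨆ c : EuclideanSpace ℝ Λ, gaussianLikelihood σ
        ((attackMatrix H L Λ).toEuclideanLin c + (loadMatrix H L).toEuclideanLin Δθ) z) /
      gaussianLikelihood σ ((loadMatrix H L).toEuclideanLin Δθ) z)

/-- The test statistic `T(z) = σ⁻² ‖P_Λ z‖²`. -/
def glrtStat (H : Matrix M V ℝ) (L : Finset M) (Λ : Finset V) (σ : ℝ)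
    (z : EuclideanSpace ℝ L) : ℝ :=
  1 / σ ^ 2 * ‖(attackProj H L Λ).toEuclideanLin z‖ ^ 2

/-- The measurement difference under the null hypothesis (no attack),
`Δz_L = H_{L,V} Δθ + Δe_L`. -/
def nullMeasurement {Ω : Type*} (H : Matrix M V ℝ) (L : Finset M) (Δθ : EuclideanSpace ℝ V)
    (e : Ω → EuclideanSpace ℝ L) (ω : Ω) : EuclideanSpace ℝ L :=
  (loadMatrix H L).toEuclideanLin Δθ + e ω

/-- Probability of false alarm: under the null hypothesis, the probability that the test declares
an attack, i.e. that the statistic exceeds the threshold `γ`. -/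
def falseAlarmProb {Ω : Type*} [MeasurableSpace Ω] (P : Measure Ω) (H : Matrix M V ℝ)
    (L : Finset M) (Λ : Finset V) (σ γ : ℝ) (Δθ : EuclideanSpace ℝ V)
    (e : Ω → EuclideanSpace ℝ L) : ℝ :=
  P.real {ω | γ < glrtStat H L Λ σ (nullMeasurement H L Δθ e ω)}

end

end FDI

/-! Since `H_{L,Λ}` has full column rank, `P_Λ` is the orthogonal projection onto its range, and the
likelihood is largest where `H_{L,Λ} c` is the projection of `z - H_{L,V} Δθ`; Pythagoras then gives
the likelihood ratio. Without an attack, the statistic is `‖P_Λ (μ + x)‖²` with `μ = σ⁻¹ H_{L,V} Δθ`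
and `x` standard Gaussian, a noncentral chi-squared variable with `|Λ|` degrees of freedom and
noncentrality `‖P_Λ μ‖²`. Expanding the Bessel function in its power series turns the integral
defining the Marcum function into the Poisson mixture of chi-squared tails, so that the false-alarm
probability is `Q_{|Λ|/2}(‖P_Λ μ‖, √γ)`. Finally, noncentral chi-squared laws with noncentralities
`l` and `l + d` differ by convolution with the one with `0` degrees of freedom and noncentrality
`d`, which lives on `[0, ∞)`; hence the tails increase with the noncentrality, and `0 ≤ ‖P_Λ μ‖ ≤ √η
/ σ`. -/

namespace FDI

open Module Set

open scoped ENNReal Matrix NNReal RealInnerProductSpace Topology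

noncomputable section

section ExponentialMoments

variable {μ ν : Measure ℝ}

theorem isFiniteMeasure_of_zero_mem_integrableExpSet (h : 0 ∈ integrableExpSet id μ) :
    IsFiniteMeasure μ := by
  simpa [integrableExpSet, integrable_const_iff_isFiniteMeasure] using h

theorem eqOn_complexMGF_of_mgf_eventuallyEq (hμ : 0 ∈ interior (integrableExpSet id μ))
    (hν : 0 ∈ interior (integrableExpSet id ν)) (h : mgf id μ =ᶠ[𝓝 0] mgf id ν) :
    EqOn (complexMGF id μ) (complexMGF id ν)
      {z | z.re ∈ interior (integrableExpSet id μ) ∩ interior (integrableExpSet id ν)} := by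
  have hconv : Convex ℝ (interior (integrableExpSet id μ) ∩ interior (integrableExpSet id ν)) :=
    convex_integrableExpSet.interior.inter convex_integrableExpSet.interior
  refine AnalyticOnNhd.eqOn_of_preconnected_of_frequently_eq
    (analyticOnNhd_complexMGF.mono fun z hz => hz.1)
    (analyticOnNhd_complexMGF.mono fun z hz => hz.2)
    (hconv.linear_preimage Complex.reLm).isPreconnected (z₀ := ((0 : ℝ) : ℂ))
    ⟨by simpa using hμ, by simpa using hν⟩ ?_
  have hreal : ∃ᶠ x : ℝ in 𝓝[≠] 0, complexMGF id μ x = complexMGF id ν x := by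
    refine ((h.filter_mono nhdsWithin_le_nhds).mono fun x hx => ?_).frequently
    rw [complexMGF_ofReal, complexMGF_ofReal, hx]
  exact (Complex.continuous_ofReal.continuousWithinAt.tendsto_nhdsWithin
    fun x hx => by simpa using hx).frequently hreal

theorem measure_ext_of_mgf_eventuallyEq (hμ : 0 ∈ interior (integrableExpSet id μ))
    (hν : 0 ∈ interior (integrableExpSet id ν)) (h : mgf id μ =ᶠ[𝓝 0] mgf id ν) : μ = ν := by
  have := isFiniteMeasure_of_zero_mem_integrableExpSet (interior_subset hμ)
  have := isFiniteMeasure_of_zero_mem_integrableExpSet (interior_subset hν)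
  refine Measure.ext_of_charFun (funext fun t => ?_)
  rw [← complexMGF_id_mul_I, ← complexMGF_id_mul_I]
  exact eqOn_complexMGF_of_mgf_eventuallyEq hμ hν h (by simpa using ⟨hμ, hν⟩)

theorem zero_mem_interior_integrableExpSet
    (h : ∀ᶠ s in 𝓝 (0 : ℝ), ∫⁻ x, ENNReal.ofReal (Real.exp (s * x)) ∂μ ≠ ∞) :
    0 ∈ interior (integrableExpSet id μ) := by
  refine mem_interior_iff_mem_nhds.2 (h.mono fun s hs => ⟨by fun_prop, ?_⟩)
  rw [hasFiniteIntegral_iff_ofReal (ae_of_all _ fun x => (Real.exp_pos _).le)]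
  exact hs.lt_top

theorem mgf_id_eq_toReal_lintegral (μ : Measure ℝ) (s : ℝ) :
    mgf id μ s = (∫⁻ x, ENNReal.ofReal (Real.exp (s * x)) ∂μ).toReal :=
  integral_eq_lintegral_of_nonneg_ae (ae_of_all _ fun x => (Real.exp_pos _).le) (by fun_prop)

theorem measure_ext_of_lintegral_exp_eventuallyEq
    (hμ : ∀ᶠ s in 𝓝 (0 : ℝ), ∫⁻ x, ENNReal.ofReal (Real.exp (s * x)) ∂μ ≠ ∞)
    (h : ∀ᶠ s in 𝓝 (0 : ℝ), ∫⁻ x, ENNReal.ofReal (Real.exp (s * x)) ∂μ =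
      ∫⁻ x, ENNReal.ofReal (Real.exp (s * x)) ∂ν) : μ = ν := by
  refine measure_ext_of_mgf_eventuallyEq (zero_mem_interior_integrableExpSet hμ)
    (zero_mem_interior_integrableExpSet ?_) (h.mono fun s hs => ?_)
  · filter_upwards [hμ, h] with s hs heq using heq ▸ hs
  · rw [mgf_id_eq_toReal_lintegral, mgf_id_eq_toReal_lintegral, hs]

end ExponentialMoments

theorem measure_Ioi_le_conv (μ : Measure ℝ) {ν : Measure ℝ} [SFinite μ] [IsProbabilityMeasure ν]
    (hν : ν (Iio 0) = 0) (c : ℝ) : μ (Ioi c) ≤ (μ ∗ ν) (Ioi c) := by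
  have hone : ν (Ici 0) = 1 := by rwa [← compl_Iio, prob_compl_eq_one_iff measurableSet_Iio]
  rw [Measure.conv, Measure.map_apply (by fun_prop) measurableSet_Ioi, ← mul_one (μ _), ← hone,
    ← Measure.prod_prod]
  exact measure_mono fun p hp => show c < p.1 + p.2 from lt_add_of_lt_of_nonneg hp.1 hp.2

section ExponentialTilting

theorem measurable_gammaPDF (a r : ℝ) : Measurable (gammaPDF a r) :=
  (measurable_gammaPDFReal a r).ennreal_ofReal

theorem exp_mul_gammaPDFReal {a r s : ℝ} (ha : 0 < a) (hr : 0 < r) (hs : s < r) (x : ℝ) :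
    Real.exp (s * x) * gammaPDFReal a r x =
      (1 - s / r) ^ (-a) * gammaPDFReal a (r - s) x := by
  have hrs : 0 < r - s := sub_pos.2 hs
  unfold gammaPDFReal
  split_ifs with hx
  · have hexp : Real.exp (-((r - s) * x)) = Real.exp (s * x) * Real.exp (-(r * x)) := by
      rw [← Real.exp_add]
      ring_nf
    have hpow : (1 - s / r) ^ (-a) = r ^ a / (r - s) ^ a := by
      rw [one_sub_div hr.ne', Real.rpow_neg (by positivity), Real.div_rpow hrs.le hr.le, inv_div]
    rw [hexp, hpow]
    field_simp
  · simp

theorem lintegral_exp_gammaMeasure {a r s : ℝ} (ha : 0 < a) (hr : 0 < r) (hs : s < r) :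
    ∫⁻ x, ENNReal.ofReal (Real.exp (s * x)) ∂(gammaMeasure a r) =
      ENNReal.ofReal ((1 - s / r) ^ (-a)) := by
  have htilt (x : ℝ) : (gammaPDF a r * fun x => ENNReal.ofReal (Real.exp (s * x))) x =
      ENNReal.ofReal ((1 - s / r) ^ (-a)) * gammaPDF a (r - s) x := by
    rw [Pi.mul_apply, gammaPDF, gammaPDF, mul_comm, ← ENNReal.ofReal_mul (Real.exp_pos _).le,
      exp_mul_gammaPDFReal ha hr hs, ENNReal.ofReal_mul]
    exact Real.rpow_nonneg (sub_nonneg.2 ((div_le_one hr).2 hs.le)) _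
  rw [gammaMeasure,
    lintegral_withDensity_eq_lintegral_mul _ (measurable_gammaPDF a r) (by fun_prop)]
  simp only [htilt]
  rw [lintegral_const_mul _ (measurable_gammaPDF a (r - s)),
    lintegral_gammaPDF_eq_one ha (sub_pos.2 hs), mul_one]

theorem exp_mul_sq_mul_gaussianPDFReal (m : ℝ) {v : ℝ≥0} (hv : v ≠ 0) {r : ℝ≥0} (hr : 0 < r)
    (x : ℝ) :
    Real.exp ((1 - r) / (2 * v) * x ^ 2) * gaussianPDFReal m v x =
      (r : ℝ) ^ (-(1 / 2) : ℝ) * Real.exp ((1 - r) / (2 * v) * m ^ 2 / r) *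
        gaussianPDFReal (m / r) (v / r) x := by
  have : (0 : ℝ) < v := by positivity
  have hexp : Real.exp ((1 - r) / (2 * v) * x ^ 2) * Real.exp (-(x - m) ^ 2 / (2 * v)) =
      Real.exp ((1 - r) / (2 * v) * m ^ 2 / r) *
        Real.exp (-(x - m / r) ^ 2 / (2 * (v / r : ℝ≥0))) := by
    rw [← Real.exp_add, ← Real.exp_add, NNReal.coe_div]
    congr 1
    field_simp
    ring
  have hsqrt : (√(2 * Real.pi * v))⁻¹ =
      (r : ℝ) ^ (-(1 / 2) : ℝ) * (√(2 * Real.pi * (v / r : ℝ≥0)))⁻¹ := by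
    rw [Real.rpow_neg r.coe_nonneg, ← Real.sqrt_eq_rpow, ← mul_inv,
      ← Real.sqrt_mul r.coe_nonneg, NNReal.coe_div]
    congr 2
    field_simp
  rw [gaussianPDFReal, gaussianPDFReal, mul_left_comm, hexp, hsqrt]
  ring

theorem lintegral_exp_mul_sq_gaussianReal (m : ℝ) (v : ℝ≥0) {s : ℝ} (hs : 2 * s * v < 1) :
    ∫⁻ x, ENNReal.ofReal (Real.exp (s * x ^ 2)) ∂(gaussianReal m v) =
      ENNReal.ofReal ((1 - 2 * s * v) ^ (-(1 / 2) : ℝ) *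
        Real.exp (s * m ^ 2 / (1 - 2 * s * v))) := by
  rcases eq_or_ne v 0 with rfl | hv
  · simp
  have hr : 0 < 1 - 2 * s * v := sub_pos.2 hs
  obtain ⟨r, hr_eq⟩ : ∃ r : ℝ≥0, (r : ℝ) = 1 - 2 * s * v := ⟨⟨_, hr.le⟩, rfl⟩
  have hs_eq : s = (1 - r) / (2 * v) := by
    rw [hr_eq]
    field_simp
    ring
  rw [← hr_eq] at hr ⊢
  have hr0 : 0 < r := hr
  have htilt (x : ℝ) :
      (gaussianPDF m v * fun x => ENNReal.ofReal (Real.exp (s * x ^ 2))) x =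
        ENNReal.ofReal ((r : ℝ) ^ (-(1 / 2) : ℝ) * Real.exp (s * m ^ 2 / r)) *
          gaussianPDF (m / r) (v / r) x := by
    rw [Pi.mul_apply, gaussianPDF, gaussianPDF, mul_comm, ← ENNReal.ofReal_mul (Real.exp_pos _).le,
      ← ENNReal.ofReal_mul (by positivity), hs_eq, exp_mul_sq_mul_gaussianPDFReal m hv hr0]
  rw [gaussianReal_of_var_ne_zero _ hv,
    lintegral_withDensity_eq_lintegral_mul _ (measurable_gaussianPDF _ _) (by fun_prop)]
  simp only [htilt]
  rw [lintegral_const_mul _ (measurable_gaussianPDF _ _),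
    lintegral_gaussianPDF_eq_one _ (div_ne_zero hv hr0.ne'), mul_one]

theorem lintegral_poissonMeasure (r : ℝ≥0) (f : ℕ → ℝ≥0∞) :
    ∫⁻ j, f j ∂(poissonMeasure r) =
      ∑' j, ENNReal.ofReal (Real.exp (-r) * r ^ j / j.factorial) * f j := by
  simp [poissonMeasure, lintegral_sum_measure]

theorem lintegral_pow_poissonMeasure (r q : ℝ≥0) :
    ∫⁻ j, (q : ℝ≥0∞) ^ j ∂(poissonMeasure r) = ENNReal.ofReal (Real.exp (r * (q - 1))) := by
  have hsum : HasSum (fun j : ℕ => Real.exp (-r) * r ^ j / j.factorial * q ^ j)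
      (Real.exp (r * (q - 1))) := by
    rw [mul_sub_one, sub_eq_neg_add, Real.exp_add, Real.exp_eq_exp_ℝ]
    refine ((NormedSpace.expSeries_div_hasSum_exp (r * q : ℝ)).mul_left _).congr_fun fun j => ?_
    ring
  rw [lintegral_poissonMeasure, ← hsum.tsum_eq,
    ENNReal.ofReal_tsum_of_nonneg (fun j => by positivity) hsum.summable]
  refine tsum_congr fun j => ?_
  rw [ENNReal.ofReal_mul (by positivity), ENNReal.ofReal_pow q.coe_nonneg,
    ENNReal.ofReal_coe_nnreal]

end ExponentialTilting

section ChiSquared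

/-- The chi-squared distribution with a real number `k` of degrees of freedom. At `k = 0` it is the
point mass at the origin, where `gammaMeasure` only has a junk value. -/
def chiSq (k : ℝ≥0) : Measure ℝ :=
  if k = 0 then Measure.dirac 0 else gammaMeasure (k / 2) (1 / 2)

/-- The noncentral chi-squared distribution with `k` degrees of freedom and noncentrality `l`, as a
mixture of chi-squared distributions by a Poisson law of mean `l / 2`. It is the law of the squared
norm of a standard Gaussian vector of dimension `k` shifted by a vector of squared norm `l`. -/
def noncentralChiSq (k l : ℝ≥0) : Measure ℝ :=
  (poissonMeasure (l / 2)).bind fun j => chiSq (k + 2 * j)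

theorem chiSq_zero : chiSq 0 = Measure.dirac 0 := if_pos rfl

theorem chiSq_of_ne_zero {k : ℝ≥0} (hk : k ≠ 0) : chiSq k = gammaMeasure (k / 2) (1 / 2) :=
  if_neg hk

instance (k : ℝ≥0) : IsProbabilityMeasure (chiSq k) := by
  rcases eq_or_ne k 0 with rfl | hk
  · rw [chiSq_zero]
    infer_instance
  · rw [chiSq_of_ne_zero hk]
    exact isProbabilityMeasure_gammaMeasure (by positivity) (by norm_num)

instance (k l : ℝ≥0) : IsProbabilityMeasure (noncentralChiSq k l) :=
  isProbabilityMeasure_bind Measurable.of_discrete.aemeasurable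
    (ae_of_all _ fun _ => inferInstance)

theorem chiSq_Iio_zero (k : ℝ≥0) : chiSq k (Iio 0) = 0 := by
  rcases eq_or_ne k 0 with rfl | hk
  · simp [chiSq_zero]
  · rw [chiSq_of_ne_zero hk, gammaMeasure, withDensity_apply _ measurableSet_Iio,
      lintegral_gammaPDF_of_nonpos le_rfl]

theorem noncentralChiSq_apply (k l : ℝ≥0) {s : Set ℝ} (hs : MeasurableSet s) :
    noncentralChiSq k l s = ∫⁻ j, chiSq (k + 2 * j) s ∂(poissonMeasure (l / 2)) :=
  Measure.bind_apply hs Measurable.of_discrete.aemeasurable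

theorem noncentralChiSq_Iio_zero (k l : ℝ≥0) : noncentralChiSq k l (Iio 0) = 0 := by
  simp [noncentralChiSq_apply k l measurableSet_Iio, chiSq_Iio_zero]

theorem noncentralChiSq_real_apply (k l : ℝ≥0) {s : Set ℝ} (hs : MeasurableSet s) :
    (noncentralChiSq k l).real s = ∑' j : ℕ,
      Real.exp (-(l / 2)) * (l / 2 : ℝ) ^ j / j.factorial * (chiSq (k + 2 * j)).real s := by
  rw [measureReal_def, noncentralChiSq_apply k l hs, ← integral_toReal
    Measurable.of_discrete.aemeasurable (ae_of_all _ fun j => measure_lt_top _ _),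
    integral_poissonMeasure]
  simp [measureReal_def]

theorem lintegral_exp_chiSq (k : ℝ≥0) {s : ℝ} (hs : s < 1 / 2) :
    ∫⁻ x, ENNReal.ofReal (Real.exp (s * x)) ∂(chiSq k) =
      ENNReal.ofReal ((1 - 2 * s) ^ (-(k / 2) : ℝ)) := by
  rcases eq_or_ne k 0 with rfl | hk
  · simp [chiSq_zero]
  · rw [chiSq_of_ne_zero hk, lintegral_exp_gammaMeasure (by positivity) (by norm_num) hs,
      div_div_eq_mul_div, div_one, mul_comm s]

theorem lintegral_exp_noncentralChiSq (k l : ℝ≥0) {s : ℝ} (hs : s < 1 / 2) :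
    ∫⁻ x, ENNReal.ofReal (Real.exp (s * x)) ∂(noncentralChiSq k l) =
      ENNReal.ofReal ((1 - 2 * s) ^ (-(k / 2) : ℝ) * Real.exp (l * s / (1 - 2 * s))) := by
  have hr : 0 < 1 - 2 * s := by linarith
  obtain ⟨q, hq⟩ : ∃ q : ℝ≥0, (q : ℝ) = (1 - 2 * s)⁻¹ := ⟨⟨_, (inv_pos.2 hr).le⟩, rfl⟩
  have hmix (j : ℕ) : ∫⁻ x, ENNReal.ofReal (Real.exp (s * x)) ∂(chiSq (k + 2 * j)) =
      ENNReal.ofReal ((1 - 2 * s) ^ (-(k / 2) : ℝ)) * (q : ℝ≥0∞) ^ j := by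
    have hexponent : -((k + 2 * j : ℝ≥0) / 2 : ℝ) = -(k / 2) - j := by
      push_cast
      ring
    rw [lintegral_exp_chiSq _ hs, hexponent, Real.rpow_sub hr, Real.rpow_natCast, div_eq_mul_inv,
      ← inv_pow, ← hq, ENNReal.ofReal_mul (by positivity), ENNReal.ofReal_pow q.coe_nonneg,
      ENNReal.ofReal_coe_nnreal]
  rw [noncentralChiSq, Measure.lintegral_bind Measurable.of_discrete.aemeasurable (by fun_prop)]
  simp only [hmix]
  rw [lintegral_const_mul _ Measurable.of_discrete, lintegral_pow_poissonMeasure,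
    ← ENNReal.ofReal_mul (by positivity), hq, NNReal.coe_div, NNReal.coe_ofNat]
  congr 3
  field_simp
  ring

theorem eq_noncentralChiSq_of_lintegral_exp {μ : Measure ℝ} {k l : ℝ≥0}
    (h : ∀ s < (1 / 2 : ℝ), ∫⁻ x, ENNReal.ofReal (Real.exp (s * x)) ∂μ =
      ENNReal.ofReal ((1 - 2 * s) ^ (-(k / 2) : ℝ) * Real.exp (l * s / (1 - 2 * s)))) :
    μ = noncentralChiSq k l := by
  have hnear : ∀ᶠ s : ℝ in 𝓝 0, s < 1 / 2 := Iio_mem_nhds (by norm_num)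
  refine measure_ext_of_lintegral_exp_eventuallyEq (hnear.mono fun s hs => ?_)
    (hnear.mono fun s hs => ?_)
  · rw [h s hs]
    exact ENNReal.ofReal_ne_top
  · rw [h s hs, lintegral_exp_noncentralChiSq k l hs]

theorem noncentralChiSq_zero_right (k : ℝ≥0) : noncentralChiSq k 0 = chiSq k :=
  (eq_noncentralChiSq_of_lintegral_exp fun s hs => by simp [lintegral_exp_chiSq k hs]).symm

theorem noncentralChiSq_conv (k k' l l' : ℝ≥0) :
    noncentralChiSq k l ∗ noncentralChiSq k' l' = noncentralChiSq (k + k') (l + l') := by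
  refine eq_noncentralChiSq_of_lintegral_exp fun s hs => ?_
  have hr : 0 < 1 - 2 * s := by linarith
  rw [Measure.lintegral_conv (by fun_prop)]
  simp only [mul_add, Real.exp_add, ENNReal.ofReal_mul (Real.exp_pos _).le]
  rw [lintegral_lintegral_mul (by fun_prop) (by fun_prop), lintegral_exp_noncentralChiSq k l hs,
    lintegral_exp_noncentralChiSq k' l' hs, ← ENNReal.ofReal_mul (by positivity), mul_mul_mul_comm,
    ← Real.rpow_add hr, ← Real.exp_add, NNReal.coe_add, NNReal.coe_add, add_mul, add_div, add_div,
    neg_add]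

theorem noncentralChiSq_real_Ioi_mono (k : ℝ≥0) (c : ℝ) :
    Monotone fun l => (noncentralChiSq k l).real (Ioi c) := by
  intro l l' hl
  obtain ⟨d, rfl⟩ := exists_add_of_le hl
  refine ENNReal.toReal_mono (measure_ne_top _ _) ?_
  simpa only [noncentralChiSq_conv, add_zero] using
    measure_Ioi_le_conv (noncentralChiSq k l) (noncentralChiSq_Iio_zero 0 d) c

end ChiSquared

section MarcumQ

/-- The density at `t > 0` of the chi distribution with `k` degrees of freedom; the integrands
defining `marcumQ` are mixtures of these densities. -/
def chiPDFReal (k t : ℝ) : ℝ :=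
  t ^ (k - 1) * Real.exp (-t ^ 2 / 2) / (2 ^ (k / 2 - 1) * Real.Gamma (k / 2))

theorem measurable_chiPDFReal (k : ℝ) : Measurable (chiPDFReal k) := by
  unfold chiPDFReal
  fun_prop

theorem chiPDFReal_nonneg {k t : ℝ} (hk : 0 ≤ k) (ht : 0 ≤ t) : 0 ≤ chiPDFReal k t := by
  have := Real.Gamma_nonneg_of_nonneg (div_nonneg hk zero_le_two)
  unfold chiPDFReal
  positivity

theorem two_mul_gammaPDFReal_sq (k : ℝ) {t : ℝ} (ht : 0 < t) :
    2 * t * gammaPDFReal (k / 2) (1 / 2) (t ^ 2) = chiPDFReal k t := by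
  have hpow : (t ^ 2) ^ (k / 2 - 1) = t ^ (k - 1) / t := by
    rw [← Real.rpow_natCast, ← Real.rpow_mul ht.le, ← Real.rpow_sub_one ht.ne']
    push_cast
    ring_nf
  have htwo : (1 / 2 : ℝ) ^ (k / 2) = (2 * 2 ^ (k / 2 - 1))⁻¹ := by
    rw [Real.rpow_sub_one two_ne_zero, one_div, Real.inv_rpow two_pos.le]
    field_simp
  rw [gammaPDFReal, if_pos (sq_nonneg t), hpow, htwo, chiPDFReal]
  field_simp

theorem lintegral_chiPDFReal_Ioi {k : ℝ≥0} (hk : k ≠ 0) {b : ℝ} (hb : 0 ≤ b) :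
    ∫⁻ t in Ioi b, ENNReal.ofReal (chiPDFReal k t) = chiSq k (Ioi (b ^ 2)) := by
  have hderiv (t : ℝ) : HasDerivWithinAt (fun t : ℝ => t ^ 2) (2 * t) (Ioi b) t := by
    simpa using (hasDerivAt_pow 2 t).hasDerivWithinAt
  have hinj : InjOn (fun t : ℝ => t ^ 2) (Ioi b) := fun x hx y hy h =>
    (sq_eq_sq₀ (hb.trans_lt hx).le (hb.trans_lt hy).le).1 h
  have himage : (fun t : ℝ => t ^ 2) '' Ioi b = Ioi (b ^ 2) := by
    ext y
    refine ⟨?_, fun hy => ⟨√y, Real.lt_sqrt_of_sq_lt hy, Real.sq_sqrt ((sq_nonneg b).trans hy.le)⟩⟩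
    rintro ⟨t, ht, rfl⟩
    exact pow_lt_pow_left₀ ht hb two_ne_zero
  rw [chiSq_of_ne_zero hk, gammaMeasure, withDensity_apply _ measurableSet_Ioi, ← himage,
    lintegral_image_eq_lintegral_abs_deriv_mul measurableSet_Ioi (fun t _ => hderiv t) hinj]
  refine setLIntegral_congr_fun measurableSet_Ioi fun t ht => ?_
  have ht0 : 0 < t := hb.trans_lt ht
  simp only [gammaPDF]
  rw [← ENNReal.ofReal_mul (abs_nonneg _), abs_of_pos (by positivity),
    two_mul_gammaPDFReal_sq k ht0]

theorem ae_chiPDFReal_nonneg (k : ℝ≥0) {b : ℝ} (hb : 0 ≤ b) :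
    0 ≤ᵐ[volume.restrict (Ioi b)] chiPDFReal k :=
  (ae_restrict_mem measurableSet_Ioi).mono fun _ ht =>
    chiPDFReal_nonneg k.coe_nonneg (hb.trans ht.le)

theorem integrableOn_chiPDFReal_Ioi {k : ℝ≥0} (hk : k ≠ 0) {b : ℝ} (hb : 0 ≤ b) :
    IntegrableOn (chiPDFReal k) (Ioi b) := by
  refine ⟨(measurable_chiPDFReal k).aestronglyMeasurable, ?_⟩
  rw [hasFiniteIntegral_iff_ofReal (ae_chiPDFReal_nonneg k hb), lintegral_chiPDFReal_Ioi hk hb]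
  exact measure_lt_top _ _

theorem integral_chiPDFReal_Ioi {k : ℝ≥0} (hk : k ≠ 0) {b : ℝ} (hb : 0 ≤ b) :
    ∫ t in Ioi b, chiPDFReal k t = (chiSq k).real (Ioi (b ^ 2)) := by
  rw [integral_eq_lintegral_of_nonneg_ae (ae_chiPDFReal_nonneg k hb)
    (measurable_chiPDFReal k).aestronglyMeasurable, lintegral_chiPDFReal_Ioi hk hb, measureReal_def]

theorem rpow_mul_rpow_mul_div_two_rpow (v : ℝ) {a t : ℝ} (ha : 0 < a) (ht : 0 < t) (j : ℕ) :
    a ^ (1 - v) * (t ^ v * (a * t / 2) ^ (2 * j + (v - 1))) =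
      (a ^ 2 / 2) ^ j * (t ^ (2 * v + 2 * j - 1) / 2 ^ ((2 * v + 2 * j) / 2 - 1)) := by
  have hapow : a ^ (1 - v) * a ^ (2 * j + (v - 1)) = (a ^ 2) ^ j := by
    rw [← Real.rpow_add ha, ← pow_mul, ← Real.rpow_natCast]
    push_cast
    ring_nf
  have htpow : t ^ v * t ^ (2 * j + (v - 1)) = t ^ (2 * v + 2 * j - 1) := by
    rw [← Real.rpow_add ht]
    ring_nf
  have htwo : (2 : ℝ) ^ (2 * j + (v - 1)) = 2 ^ j * 2 ^ ((2 * v + 2 * j) / 2 - 1) := by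
    rw [← Real.rpow_natCast, ← Real.rpow_add two_pos]
    ring_nf
  rw [Real.div_rpow (by positivity) two_pos.le, Real.mul_rpow ha.le ht.le, htwo, div_pow, ← hapow,
    ← htpow]
  field_simp

theorem marcumQ_integrand_eq_tsum (v : ℝ) {a t : ℝ} (ha : 0 < a) (ht : 0 < t) :
    a ^ (1 - v) * (t ^ v * Real.exp (-(t ^ 2 + a ^ 2) / 2) * besselI (v - 1) (a * t)) =
      ∑' j : ℕ, Real.exp (-(a ^ 2 / 2)) * (a ^ 2 / 2) ^ j / j.factorial *
        chiPDFReal (2 * v + 2 * j) t := by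
  have hexp : Real.exp (-(t ^ 2 + a ^ 2) / 2) =
      Real.exp (-(a ^ 2 / 2)) * Real.exp (-t ^ 2 / 2) := by
    rw [← Real.exp_add]
    ring_nf
  rw [besselI, ← tsum_mul_left, ← tsum_mul_left]
  refine tsum_congr fun j => ?_
  have hGamma : Real.Gamma (j + (v - 1) + 1) = Real.Gamma ((2 * v + 2 * j) / 2) := by
    ring_nf
  calc _ = Real.exp (-(a ^ 2 / 2)) * Real.exp (-t ^ 2 / 2) *
        (a ^ (1 - v) * (t ^ v * (a * t / 2) ^ (2 * j + (v - 1)))) /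
          (j.factorial * Real.Gamma ((2 * v + 2 * j) / 2)) := by
        rw [hexp, hGamma]
        ring
    _ = _ := by
        rw [rpow_mul_rpow_mul_div_two_rpow v ha ht, chiPDFReal]
        ring

theorem integral_tsum_chiPDFReal {k : ℝ≥0} (hk : k ≠ 0) {w : ℕ → ℝ} (hw : Summable w)
    (hw0 : ∀ j, 0 ≤ w j) {b : ℝ} (hb : 0 ≤ b) :
    ∫ t in Ioi b, ∑' j, w j * chiPDFReal (k + 2 * j) t =
      ∑' j, w j * (chiSq (k + 2 * j)).real (Ioi (b ^ 2)) := by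
  have hkj (j : ℕ) : k + 2 * j ≠ 0 := by positivity
  have hcast (j : ℕ) : (k + 2 * j : ℝ) = (k + 2 * j : ℝ≥0) := by push_cast; rfl
  have hterm (j : ℕ) : ∫ t in Ioi b, ‖w j * chiPDFReal (k + 2 * j) t‖ =
      w j * (chiSq (k + 2 * j)).real (Ioi (b ^ 2)) := by
    rw [← integral_chiPDFReal_Ioi (hkj j) hb, ← integral_const_mul, hcast]
    refine setIntegral_congr_fun measurableSet_Ioi fun t ht => Real.norm_of_nonneg ?_
    exact mul_nonneg (hw0 j) (chiPDFReal_nonneg (NNReal.coe_nonneg _) (hb.trans ht.le))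
  have hsummable : Summable fun j => ∫ t in Ioi b, ‖w j * chiPDFReal (k + 2 * j) t‖ := by
    simp only [hterm]
    exact hw.of_nonneg_of_le (fun j => mul_nonneg (hw0 j) measureReal_nonneg)
      fun j => mul_le_of_le_one_right (hw0 j) measureReal_le_one
  rw [← (hasSum_integral_of_summable_integral_norm
    (fun j => by
      rw [hcast]
      exact (integrableOn_chiPDFReal_Ioi (hkj j) hb).const_mul (w j)) hsummable).tsum_eq]
  refine tsum_congr fun j => ?_
  rw [integral_const_mul, hcast, integral_chiPDFReal_Ioi (hkj j) hb]

theorem marcumQ_zero_left {k : ℝ≥0} (hk : k ≠ 0) {b : ℝ} (hb : 0 ≤ b) :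
    marcumQ (k / 2) 0 b = (chiSq k).real (Ioi (b ^ 2)) := by
  rw [marcumQ, if_pos rfl, ← integral_chiPDFReal_Ioi hk hb, ← integral_const_mul]
  refine integral_congr_ae (ae_of_all _ fun t => ?_)
  simp only [chiPDFReal, mul_div_cancel₀ (k : ℝ) two_ne_zero]
  ring

theorem marcumQ_eq_noncentralChiSq {k : ℝ≥0} (hk : k ≠ 0) (a : ℝ≥0) {b : ℝ} (hb : 0 ≤ b) :
    marcumQ (k / 2) a b = (noncentralChiSq k (a ^ 2)).real (Ioi (b ^ 2)) := by
  rcases eq_or_ne a 0 with rfl | ha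
  · rw [zero_pow two_ne_zero, noncentralChiSq_zero_right, NNReal.coe_zero,
      marcumQ_zero_left hk hb]
  have ha' : (0 : ℝ) < a := by positivity
  have hweight : Summable fun j : ℕ =>
      Real.exp (-(a ^ 2 / 2)) * (a ^ 2 / 2 : ℝ) ^ j / j.factorial := by
    simpa only [mul_div_assoc] using (Real.summable_pow_div_factorial (a ^ 2 / 2)).mul_left _
  rw [marcumQ, if_neg ha'.ne', ← integral_const_mul, noncentralChiSq_real_apply _ _
    measurableSet_Ioi, NNReal.coe_pow,
    ← integral_tsum_chiPDFReal hk hweight (fun j => by positivity) hb]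
  refine setIntegral_congr_fun measurableSet_Ioi fun t ht => ?_
  simpa only [mul_div_cancel₀ (k : ℝ) two_ne_zero] using
    marcumQ_integrand_eq_tsum (k / 2) ha' (hb.trans_lt ht)

theorem marcumQ_monotoneOn_left {v : ℝ} (hv : 0 < v) {b : ℝ} (hb : 0 ≤ b) :
    MonotoneOn (fun a => marcumQ v a b) (Ici 0) := by
  intro a ha a' ha' h
  lift a to ℝ≥0 using ha
  lift a' to ℝ≥0 using ha'
  lift v to ℝ≥0 using hv.le
  have hk : 2 * v ≠ 0 := mul_ne_zero two_ne_zero (NNReal.coe_pos.1 hv).ne'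
  have hv2 : (v : ℝ) = (2 * v : ℝ≥0) / 2 := by simp
  simp only [hv2, marcumQ_eq_noncentralChiSq hk _ hb]
  exact noncentralChiSq_real_Ioi_mono (2 * v) (b ^ 2) (by gcongr; exact_mod_cast h)

end MarcumQ

section StandardGaussian

variable {E : Type*} [NormedAddCommGroup E] [InnerProductSpace ℝ E]

theorem lintegral_prod_pi {ι : Type*} [Fintype ι] {X : ι → Type*} [∀ i, MeasurableSpace (X i)]
    (μ : ∀ i, Measure (X i)) [∀ i, IsProbabilityMeasure (μ i)] {f : ∀ i, X i → ℝ≥0∞}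
    (hf : ∀ i, Measurable (f i)) :
    ∫⁻ x, ∏ i, f i (x i) ∂(Measure.pi μ) = ∏ i, ∫⁻ x, f i x ∂(μ i) := by
  rw [lintegral_prod_eq_prod_lintegral_of_indepFun _ (fun i (x : ∀ i, X i) => f i (x i))
    (iIndepFun_pi fun i => (hf i).aemeasurable) fun i => (hf i).comp (measurable_pi_apply i)]
  exact Finset.prod_congr rfl fun i _ => (measurePreserving_eval μ i).lintegral_comp (hf i)

theorem norm_add_sum_smul_sq {ι : Type*} [Fintype ι] (b : OrthonormalBasis ι ℝ E) (m : E)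
    (x : ι → ℝ) : ‖m + ∑ i, x i • b i‖ ^ 2 = ∑ i, (⟪b i, m⟫ + x i) ^ 2 := by
  rw [← b.sum_sq_inner_right]
  simp only [inner_add_right, b.orthonormal.inner_right_fintype]

theorem lintegral_exp_mul_add_sq_gaussianReal (m : ℝ) {s : ℝ} (hs : s < 1 / 2) :
    ∫⁻ x, ENNReal.ofReal (Real.exp (s * (m + x) ^ 2)) ∂(gaussianReal 0 1) =
      ENNReal.ofReal ((1 - 2 * s) ^ (-(1 / 2) : ℝ) * Real.exp (s * m ^ 2 / (1 - 2 * s))) := by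
  have hshift : gaussianReal m 1 = (gaussianReal 0 1).map (m + ·) := by
    rw [gaussianReal_map_const_add, zero_add]
  have hmoment := lintegral_exp_mul_sq_gaussianReal m 1 (s := s) (by norm_num; linarith)
  rw [hshift, lintegral_map (by fun_prop) (by fun_prop)] at hmoment
  simpa only [NNReal.coe_one, mul_one] using hmoment

variable [FiniteDimensional ℝ E] [MeasurableSpace E] [BorelSpace E]

theorem lintegral_exp_mul_norm_add_sq_stdGaussian (m : E) {s : ℝ} (hs : s < 1 / 2) :
    ∫⁻ x, ENNReal.ofReal (Real.exp (s * ‖m + x‖ ^ 2)) ∂(stdGaussian E) =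
      ENNReal.ofReal ((1 - 2 * s) ^ (-(finrank ℝ E / 2) : ℝ) *
        Real.exp (‖m‖ ^ 2 * s / (1 - 2 * s))) := by
  have hr : 0 < 1 - 2 * s := by linarith
  let b := stdOrthonormalBasis ℝ E
  have hfactor (x : Fin (finrank ℝ E) → ℝ) :
      ENNReal.ofReal (Real.exp (s * ‖m + ∑ i, x i • b i‖ ^ 2)) =
        ∏ i, ENNReal.ofReal (Real.exp (s * (⟪b i, m⟫ + x i) ^ 2)) := by
    rw [norm_add_sum_smul_sq, Finset.mul_sum, Real.exp_sum,
      ENNReal.ofReal_prod_of_nonneg fun i _ => (Real.exp_pos _).le]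
  rw [stdGaussian_eq_map_pi_orthonormalBasis b, lintegral_map (by fun_prop) (by fun_prop)]
  simp only [hfactor]
  rw [lintegral_prod_pi (fun _ => gaussianReal 0 1)
    (f := fun i t => ENNReal.ofReal (Real.exp (s * (⟪b i, m⟫ + t) ^ 2))) fun i => by fun_prop]
  simp only [lintegral_exp_mul_add_sq_gaussianReal _ hs]
  rw [← ENNReal.ofReal_prod_of_nonneg fun i _ => by positivity, Finset.prod_mul_distrib,
    Finset.prod_const, Finset.card_univ, Fintype.card_fin, ← Real.rpow_natCast,
    ← Real.rpow_mul hr.le, ← Real.exp_sum, ← Finset.sum_div, ← Finset.mul_sum,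
    b.sum_sq_inner_right, mul_comm s]
  ring_nf

theorem hasLaw_norm_add_sq_stdGaussian (m : E) :
    HasLaw (fun x => ‖m + x‖ ^ 2) (noncentralChiSq (finrank ℝ E) (‖m‖₊ ^ 2)) (stdGaussian E) where
  aemeasurable := by fun_prop
  map_eq := eq_noncentralChiSq_of_lintegral_exp fun s hs => by
    rw [lintegral_map (by fun_prop) (by fun_prop), lintegral_exp_mul_norm_add_sq_stdGaussian m hs]
    simp

theorem hasLaw_orthogonalProjectionOnto_stdGaussian (K : Submodule ℝ E) :
    HasLaw K.orthogonalProjectionOnto (stdGaussian K) (stdGaussian E) where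
  aemeasurable := by fun_prop
  map_eq := by
    refine Measure.ext_of_charFun (funext fun t => ?_)
    rw [charFun_apply, integral_map (by fun_prop) (by fun_prop)]
    simp only [Submodule.inner_orthogonalProjectionOnto_eq_of_mem_right]
    rw [← charFun_apply, charFun_stdGaussian, charFun_stdGaussian, Submodule.coe_norm]

theorem hasLaw_norm_starProjection_add_sq_stdGaussian (K : Submodule ℝ E) (m : E) :
    HasLaw (fun x => ‖K.starProjection (m + x)‖ ^ 2)
      (noncentralChiSq (finrank ℝ K) (‖K.starProjection m‖₊ ^ 2)) (stdGaussian E) := by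
  have h := (hasLaw_norm_add_sq_stdGaussian (K.orthogonalProjectionOnto m)).fun_comp
    (hasLaw_orthogonalProjectionOnto_stdGaussian K)
  simp only [← map_add] at h
  exact h

theorem hasLaw_inv_smul_multivariateGaussian {ι : Type*} [Fintype ι] [DecidableEq ι] {σ : ℝ}
    (hσ : σ ≠ 0) :
    HasLaw (fun x => σ⁻¹ • x) (stdGaussian (EuclideanSpace ℝ ι))
      (multivariateGaussian 0 (σ ^ 2 • (1 : Matrix ι ι ℝ))) where
  aemeasurable := by fun_prop
  map_eq := by
    refine Measure.ext_of_charFun (funext fun t => ?_)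
    have hvar : (σ⁻¹ • t).ofLp ⬝ᵥ (σ ^ 2 • (1 : Matrix ι ι ℝ)) *ᵥ (σ⁻¹ • t).ofLp = ‖t‖ ^ 2 := by
      rw [Matrix.smul_mulVec, Matrix.one_mulVec, EuclideanSpace.real_norm_sq_eq, dotProduct,
        Finset.sum_congr rfl fun i _ => ?_]
      simp
      field_simp
    rw [charFun_map_smul, charFun_multivariateGaussian (Matrix.PosSemidef.one.smul (sq_nonneg σ)),
      hvar, charFun_stdGaussian]
    simp [neg_div]

end StandardGaussian

section MatrixProjection

variable {m n : Type*} [Fintype m] [Fintype n] [DecidableEq n] {A : Matrix m n ℝ}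

theorem isUnit_det_transpose_mul_self (hA : LinearIndependent ℝ A.col) : IsUnit (Aᵀ * A).det := by
  have hpos := Matrix.PosDef.conjTranspose_mul_self A (Matrix.mulVec_injective_iff.2 hA)
  rw [Matrix.conjTranspose_eq_transpose_of_trivial] at hpos
  exact (Matrix.isUnit_iff_isUnit_det _).1 hpos.isUnit

theorem toEuclideanLin_eq_starProjection_range [DecidableEq m] (hA : LinearIndependent ℝ A.col)
    (x : EuclideanSpace ℝ m) :
    (A * (Aᵀ * A)⁻¹ * Aᵀ).toEuclideanLin x =
      (LinearMap.range A.toEuclideanLin).starProjection x := by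
  have hnormal : Aᵀ * (A * (Aᵀ * A)⁻¹ * Aᵀ) = Aᵀ := by
    rw [Matrix.mul_assoc, ← Matrix.mul_assoc, Matrix.mul_nonsing_inv_cancel_left]
    exact isUnit_det_transpose_mul_self hA
  refine (Submodule.eq_starProjection_of_mem_of_inner_eq_zero ?_ ?_).symm
  · refine ⟨((Aᵀ * A)⁻¹ * Aᵀ).toEuclideanLin x, ?_⟩
    simp [Matrix.toLpLin_apply, Matrix.mul_assoc]
  · rintro _ ⟨c, rfl⟩
    have hresidual : Aᵀ.toEuclideanLin (x - (A * (Aᵀ * A)⁻¹ * Aᵀ).toEuclideanLin x) = 0 := by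
      rw [map_sub, Matrix.toLpLin_apply _ _ Aᵀ (Matrix.toEuclideanLin _ x),
        Matrix.toLpLin_apply _ _ (A * _ * _), Matrix.mulVec_mulVec, hnormal,
        ← Matrix.toLpLin_apply, sub_self]
    rw [← LinearMap.adjoint_inner_left, ← Matrix.toEuclideanLin_conjTranspose_eq_adjoint,
      Matrix.conjTranspose_eq_transpose_of_trivial, hresidual, inner_zero_left]

theorem finrank_range_toEuclideanLin {m : Type*} {A : Matrix m n ℝ}
    (hA : LinearIndependent ℝ A.col) :
    finrank ℝ (LinearMap.range A.toEuclideanLin) = Fintype.card n := by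
  have hinj : Function.Injective A.toEuclideanLin := fun x y h =>
    WithLp.ofLp_injective 2 (Matrix.mulVec_injective_iff.2 hA (WithLp.toLp_injective 2 h))
  rw [LinearMap.finrank_range_of_inj hinj, finrank_euclideanSpace]

end MatrixProjection

section LikelihoodRatio

variable {M : Type*} {L : Finset M}

theorem gaussianLikelihood_pos {σ : ℝ} (hσ : σ ≠ 0) (m z : EuclideanSpace ℝ L) :
    0 < gaussianLikelihood σ m z := by
  unfold gaussianLikelihood
  positivity

theorem gaussianLikelihood_le_of_norm_sub_le {σ : ℝ} {m m' z : EuclideanSpace ℝ L}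
    (h : ‖z - m'‖ ≤ ‖z - m‖) : gaussianLikelihood σ m z ≤ gaussianLikelihood σ m' z := by
  unfold gaussianLikelihood
  gcongr

theorem iSup_gaussianLikelihood {F : Type*} [AddCommGroup F] [Module ℝ F]
    (T : F →ₗ[ℝ] EuclideanSpace ℝ L) (σ : ℝ) (m z : EuclideanSpace ℝ L) :
    ⨆ c, gaussianLikelihood σ (T c + m) z =
      gaussianLikelihood σ m z *
        Real.exp (‖(LinearMap.range T).starProjection (z - m)‖ ^ 2 / (2 * σ ^ 2)) := by
  set K := LinearMap.range T
  obtain ⟨c₀, hc₀⟩ : K.starProjection (z - m) ∈ K := Submodule.starProjection_apply_mem _ _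
  have hresidual (c : F) : z - (T c + m) = z - m - T c := by abel
  have hmax : IsGreatest (range fun c => gaussianLikelihood σ (T c + m) z)
      (gaussianLikelihood σ (T c₀ + m) z) := by
    refine ⟨mem_range_self c₀, ?_⟩
    rintro _ ⟨c, rfl⟩
    refine gaussianLikelihood_le_of_norm_sub_le ?_
    rw [hresidual, hresidual, hc₀, Submodule.starProjection_minimal]
    exact ciInf_le ⟨0, by rintro _ ⟨y, rfl⟩; positivity⟩ (⟨T c, c, rfl⟩ : K)
  have hpythagoras := Submodule.norm_sq_eq_add_norm_sq_starProjection (z - m) K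
  rw [Submodule.starProjection_orthogonal_val] at hpythagoras
  rw [iSup, hmax.csSup_eq, gaussianLikelihood, gaussianLikelihood, hresidual, hc₀,
    mul_assoc (_ ^ _), ← Real.exp_add, ← add_div, hpythagoras, neg_add, neg_add_cancel_comm]

variable [DecidableEq M] {V : Type*} [DecidableEq V] {H : Matrix M V ℝ} {Λ : Finset V} {σ : ℝ}

theorem attackProj_toEuclideanLin_apply (hrank : LinearIndependent ℝ (attackMatrix H L Λ).col)
    (z : EuclideanSpace ℝ L) :
    (attackProj H L Λ).toEuclideanLin z =
      (LinearMap.range (attackMatrix H L Λ).toEuclideanLin).starProjection z :=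
  toEuclideanLin_eq_starProjection_range hrank z

theorem logGLR_eq_glrtStat [Fintype V] (hrank : LinearIndependent ℝ (attackMatrix H L Λ).col)
    (hσ : σ ≠ 0) {x : EuclideanSpace ℝ V}
    (hx : (attackProj H L Λ).toEuclideanLin ((loadMatrix H L).toEuclideanLin x) = 0)
    (z : EuclideanSpace ℝ L) : logGLR H L Λ σ x z = glrtStat H L Λ σ z := by
  rw [logGLR, iSup_gaussianLikelihood, mul_div_cancel_left₀ _ (gaussianLikelihood_pos hσ _ _).ne',
    Real.log_exp, ← attackProj_toEuclideanLin_apply hrank, map_sub, hx, sub_zero, glrtStat]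
  field_simp

end LikelihoodRatio

section FalseAlarm

variable {M V Ω : Type*} [DecidableEq M] [DecidableEq V] [MeasurableSpace Ω] {P : Measure Ω}
  {H : Matrix M V ℝ} {L : Finset M} {Λ : Finset V} {σ : ℝ} {e : Ω → EuclideanSpace ℝ L}

theorem glrtStat_eq_norm_starProjection_inv_smul_sq
    (hrank : LinearIndependent ℝ (attackMatrix H L Λ).col)
    (z : EuclideanSpace ℝ L) :
    glrtStat H L Λ σ z =
      ‖(LinearMap.range (attackMatrix H L Λ).toEuclideanLin).starProjection (σ⁻¹ • z)‖ ^ 2 := by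
  rw [glrtStat, attackProj_toEuclideanLin_apply hrank, map_smul, norm_smul, mul_pow,
    Real.norm_eq_abs, sq_abs, inv_pow, one_div]

theorem hasLaw_glrtStat_nullMeasurement [Fintype V]
    (hrank : LinearIndependent ℝ (attackMatrix H L Λ).col)
    (hσ : σ ≠ 0) (he : HasLaw e (multivariateGaussian 0 (σ ^ 2 • (1 : Matrix L L ℝ))) P)
    (Δθ : EuclideanSpace ℝ V) :
    HasLaw (fun ω => glrtStat H L Λ σ (nullMeasurement H L Δθ e ω))
      (noncentralChiSq Λ.card (‖(LinearMap.range (attackMatrix H L Λ).toEuclideanLin).starProjection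
        (σ⁻¹ • (loadMatrix H L).toEuclideanLin Δθ)‖₊ ^ 2)) P := by
  have h := ((hasLaw_norm_starProjection_add_sq_stdGaussian
    (LinearMap.range (attackMatrix H L Λ).toEuclideanLin)
    (σ⁻¹ • (loadMatrix H L).toEuclideanLin Δθ)).fun_comp
      (hasLaw_inv_smul_multivariateGaussian hσ)).fun_comp he
  rw [finrank_range_toEuclideanLin hrank, Fintype.card_coe] at h
  simpa only [glrtStat_eq_norm_starProjection_inv_smul_sq hrank, nullMeasurement, smul_add] using h

theorem falseAlarmProb_eq_marcumQ [Fintype V] (hΛ : Λ.Nonempty)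
    (hrank : LinearIndependent ℝ (attackMatrix H L Λ).col) (hσ : 0 < σ)
    (he : HasLaw e (multivariateGaussian 0 (σ ^ 2 • (1 : Matrix L L ℝ))) P) {γ : ℝ} (hγ : 0 ≤ γ)
    (Δθ : EuclideanSpace ℝ V) :
    falseAlarmProb P H L Λ σ γ Δθ e =
      marcumQ (Λ.card / 2)
        (‖(LinearMap.range (attackMatrix H L Λ).toEuclideanLin).starProjection
          ((loadMatrix H L).toEuclideanLin Δθ)‖ / σ) √γ := by
  have hcard : (Λ.card : ℝ≥0) ≠ 0 := Nat.cast_ne_zero.2 hΛ.card_pos.ne'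
  have hmarcum (a : ℝ≥0) : marcumQ (Λ.card / 2) a √γ =
      (noncentralChiSq Λ.card (a ^ 2)).real (Ioi γ) := by
    have h := marcumQ_eq_noncentralChiSq hcard a (Real.sqrt_nonneg γ)
    rwa [Real.sq_sqrt hγ, NNReal.coe_natCast] at h
  have hscale (w : EuclideanSpace ℝ L) : ‖w‖ / σ = ‖σ⁻¹ • w‖₊ := by
    rw [coe_nnnorm, norm_smul, norm_inv, Real.norm_of_nonneg hσ.le, inv_mul_eq_div]
  rw [hscale, hmarcum, ← map_smul]
  exact (hasLaw_glrtStat_nullMeasurement hrank hσ.ne' he Δθ).measureReal_eq measurableSet_Ioi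

end FalseAlarm

end

end FDI

theorem proposition2 {M V Ω : Type*} [Fintype M] [DecidableEq M] [Fintype V] [DecidableEq V]
    [MeasurableSpace Ω] (P : Measure Ω) [IsProbabilityMeasure P]
    (H : Matrix M V ℝ) (L : Finset M) (Λ : Finset V) (hΛ : Λ.Nonempty)
    (hrank : LinearIndependent ℝ (FDI.attackMatrix H L Λ).col)
    (σ η γ : ℝ) (hσ : 0 < σ) (hγ : 0 ≤ γ)
    (e : Ω → EuclideanSpace ℝ L)
    (he : HasLaw e (multivariateGaussian 0 (σ ^ 2 • (1 : Matrix L L ℝ))) P)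
    (Δθ : EuclideanSpace ℝ V)
    (hη : ‖(FDI.loadMatrix H L).toEuclideanLin Δθ‖ ^ 2 < η) :
    (∀ (x : EuclideanSpace ℝ V) (z : EuclideanSpace ℝ L),
        (FDI.attackProj H L Λ).toEuclideanLin ((FDI.loadMatrix H L).toEuclideanLin x) = 0 →
        FDI.logGLR H L Λ σ x z = FDI.glrtStat H L Λ σ z) ∧
      FDI.marcumQ ((Λ.card : ℝ) / 2) 0 (Real.sqrt γ)
        ≤ FDI.falseAlarmProb P H L Λ σ γ Δθ e ∧
      FDI.falseAlarmProb P H L Λ σ γ Δθ e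
        ≤ FDI.marcumQ ((Λ.card : ℝ) / 2) (Real.sqrt η / σ) (Real.sqrt γ) := by
  have hdim : (0 : ℝ) < Λ.card / 2 := by
    have := hΛ.card_pos
    positivity
  have hmono := FDI.marcumQ_monotoneOn_left hdim (Real.sqrt_nonneg γ)
  have hη0 : 0 ≤ √η / σ := by positivity
  rw [FDI.falseAlarmProb_eq_marcumQ hΛ hrank hσ he hγ]
  set m := (FDI.loadMatrix H L).toEuclideanLin Δθ
  set K := LinearMap.range (FDI.attackMatrix H L Λ).toEuclideanLin
  have hPm0 : 0 ≤ ‖K.starProjection m‖ / σ := by positivity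
  have hPm : ‖K.starProjection m‖ / σ ≤ √η / σ := by
    gcongr
    exact (K.norm_starProjection_apply_le m).trans (Real.le_sqrt_of_sq_le hη.le)
  exact ⟨fun x z hx => FDI.logGLR_eq_glrtStat hrank hσ.ne' hx z,
    hmono Set.self_mem_Ici hPm0 hPm0, hmono hPm0 hη0 hPm⟩
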